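/- Let $K$ be a field and let $R = K\langle x,y\rangle/(xy-1)$ be the algebraic Toeplitz (Jacobson) algebra. Let $I=\langle 1-yx\rangle$ be the two-sided ideal of $R$ generated by $1-yx$, and let $S_1=R(1-yx)$, a left ideal of $R$ regarded as a left $R$-module. Let $M$ be a left $R$-module of finite length and let $k\ge 0$ be an integer. (1) If $M$ has no direct summand isomorphic to $S_1$, then $\operatorname{Ext}^1_R(M,S_1^{\oplus k})$ and $M/IM$ are finite-dimensional over $K$, the length $\ell(IM)$ of the $R$-module $IM$ is finite, and $$\dim_K \operatorname{Ext}^1_R(M,S_1^{\oplus k}) = k\,\bigl[\dim_K M/IM-\ell(IM)\bigr].$$ (2) In general, there is a largest integer $d(M)\ge 0$ such that $M=N\oplus M'$ for some submodules $N\cong S_1^{\oplus d(M)}$ and $M'$. For every direct summand $N$ of $M$ with $N\cong S_1^{\oplus d(M)}$, the module $M/N$ has no direct summand isomorphic to $S_1$, the spaces $\operatorname{Ext}^1_R(M,S_1^{\oplus k})$ and $\operatorname{Ext}^1_R(M/N,S_1^{\oplus k})$ are finite-dimensional over $K$, and $$\dim_K \operatorname{Ext}^1_R(M,S_1^{\oplus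 k})=\dim_K \operatorname{Ext}^1_R(M/N,S_1^{\oplus k}).$$ -/

import Mathlib

open CategoryTheory

universe u

namespace ToeplitzJacobson

/-- The defining relation `x * y = 1` on the free algebra `K⟨x, y⟩`, where the generator `0` is `x`
and the generator `1` is `y`. -/
inductive Rel (K : Type u) [Field K] :
    FreeAlgebra K (Fin 2) → FreeAlgebra K (Fin 2) → Prop
  | xy : Rel K (FreeAlgebra.ι K 0 * FreeAlgebra.ι K 1) 1

/-- The Toeplitz-Jacobson algebra `R = K⟨x, y⟩ / (xy - 1)`. -/
abbrev Alg (K : Type u) [Field K] : Type u := RingQuot (Rel K)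

/-- The generator `x` of `R`. -/
noncomputable def x (K : Type u) [Field K] : Alg K :=
  RingQuot.mkAlgHom K (Rel K) (FreeAlgebra.ι K 0)

/-- The generator `y` of `R`. -/
noncomputable def y (K : Type u) [Field K] : Alg K :=
  RingQuot.mkAlgHom K (Rel K) (FreeAlgebra.ι K 1)

/-- The two-sided ideal `I = ⟨1 - yx⟩` of `R`, regarded as a left ideal. -/
noncomputable def I (K : Type u) [Field K] : Ideal (Alg K) :=
  (TwoSidedIdeal.span {1 - y K * x K}).asIdeal

/-- The left ideal `S₁ = R (1 - yx)`; its coercion to a type is the left `R`-module `S₁`. -/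
noncomputable def S₁ (K : Type u) [Field K] : Ideal (Alg K) :=
  Ideal.span {1 - y K * x K}

/-- The submodule `N` is a direct summand of `M` that is isomorphic to `S₁^{⊕ d}`. -/
def IsSummand {K : Type u} [Field K] {M : Type u} [AddCommGroup M] [Module (Alg K) M]
    (N : Submodule (Alg K) M) (d : ℕ) : Prop :=
  (∃ M' : Submodule (Alg K) M, IsCompl N M') ∧ Nonempty (N ≃ₗ[Alg K] (Fin d → S₁ K))

/-- `M` has no direct summand isomorphic to `S₁`. -/
def NoS₁Summand (K : Type u) [Field K] (M : Type u) [AddCommGroup M] [Module (Alg K) M] : Prop :=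
  ¬ ∃ N M' : Submodule (Alg K) M, IsCompl N M' ∧ Nonempty (N ≃ₗ[Alg K] S₁ K)

/-- `d(M)`: the largest `d` such that `M = S₁^{⊕ d} ⊕ M'` for some submodule `M'`. -/
noncomputable def d (K : Type u) [Field K] (M : Type u) [AddCommGroup M] [Module (Alg K) M] : ℕ :=
  sSup {n : ℕ | ∃ N : Submodule (Alg K) M, IsSummand N n}

/-- The submodule `IM` of `M`, spanned by the products `a m` with `a ∈ I`, `m ∈ M`. -/
noncomputable def IM (K : Type u) [Field K] (M : Type u) [AddCommGroup M] [Module (Alg K) M] :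
    Submodule (Alg K) M :=
  I K • (⊤ : Submodule (Alg K) M)

/-- The `K`-vector space `Ext¹_R(M, S₁^{⊕ k})`, computed in the category of left `R`-modules. -/
abbrev ExtS₁ (K : Type u) [Field K] (M : Type u) [AddCommGroup M] [Module (Alg K) M] (k : ℕ) :
    Type u :=
  Abelian.Ext.{u} (ModuleCat.of (Alg K) M) (ModuleCat.of (Alg K) (Fin k → S₁ K)) 1

end ToeplitzJacobson

namespace ToeplitzJacobson

/-! ### The algebra and its action on sequences by shifts. -/

section Algebra

variable (K : Type u) [Field K]

/-! Write `e = 1 - yx`, an idempotent with `xe = ey = 0`. Everything rests on the coresolution `0 →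
S₁ → Seq → Germ → 0`: `S₁` embeds in the shift module of all `K`-sequences as the finitely supported
ones (`mem_range_toSeq_iff`), and `Seq` is injective. The long exact sequence then computes `Ext¹(M,
S₁)` from three Hom spaces.

A homomorphism into `Seq` is determined by its zeroth coordinate, a functional killing `yM`, so
`Hom(M, Seq)` is the dual of `eM` (`homSeqEquiv`). Since `IM` is a direct sum of copies of `S₁`
indexed by a basis of `eM` (`length_IM_eq_card`), its dimension is the length of `IM`. Next, `e`
kills `Germ`, so `Hom(M, Germ)` only sees `M/IM`, a finite-length `K[y, y⁻¹]`-module and hence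
finite dimensional; it is the dual of `M/IM` (`dualToGerm_bijective`). Finally, `S₁` is simple and
projective, so a nonzero map `M → S₁` would split off a copy of `S₁`; without such summands `Hom(M,
S₁) = 0`, and the formula follows by counting dimensions.

In general, length bounds the number of copies of `S₁` that split off. A maximal such summand is
projective, so dividing by it leaves `Ext¹` unchanged. -/

theorem x_mul_y : x K * y K = 1 := by
  have h := RingQuot.mkAlgHom_rel K (Rel.xy (K := K))
  simpa [x, y] using h

/-- The idempotent `e = 1 - yx`. -/
noncomputable def e : Alg K := 1 - y K * x K

theorem x_mul_e : x K * e K = 0 := by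
  rw [e, mul_sub, ← mul_assoc, x_mul_y]; simp

theorem e_mul_y : e K * y K = 0 := by
  rw [e, sub_mul, mul_assoc, x_mul_y]; simp

theorem e_mul_e : e K * e K = e K := by
  nth_rewrite 1 [e]
  rw [sub_mul, mul_assoc, x_mul_e]
  simp

theorem x_pow_mul_y_pow (n : ℕ) : x K ^ n * y K ^ n = 1 := by
  induction n with
  | zero => simp
  | succ n ih =>
    rw [pow_succ, pow_succ', mul_assoc, ← mul_assoc (x K) (y K), x_mul_y, one_mul, ih]

variable {K}

/-- Induction principle for the Toeplitz-Jacobson algebra. -/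
theorem alg_induction {p : Alg K → Prop} (scalar : ∀ c : K, p (algebraMap K (Alg K) c))
    (hx : p (x K)) (hy : p (y K)) (mul : ∀ a b, p a → p b → p (a * b))
    (add : ∀ a b, p a → p b → p (a + b)) (a : Alg K) : p a := by
  obtain ⟨b, rfl⟩ := RingQuot.mkAlgHom_surjective K (Rel K) a
  induction b using FreeAlgebra.induction with
  | grade0 r => simpa using scalar r
  | grade1 i =>
    fin_cases i
    · exact hx
    · exact hy
  | mul a b ha hb => simpa using mul _ _ ha hb
  | add a b ha hb => simpa using add _ _ ha hb

section Linear

variable {V W : Type*} [AddCommGroup V] [Module (Alg K) V] [Module K V] [IsScalarTower K (Alg K) V]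
  [AddCommGroup W] [Module (Alg K) W] [Module K W] [IsScalarTower K (Alg K) W]

/-- A `K`-linear map commuting with `x` and `y` is `R`-linear. -/
def linearMapOfCommutes (f : V →ₗ[K] W) (hx : ∀ v, f (x K • v) = x K • f v)
    (hy : ∀ v, f (y K • v) = y K • f v) : V →ₗ[Alg K] W where
  toFun := f
  map_add' := f.map_add
  map_smul' a := by
    refine alg_induction (p := fun a => ∀ v, f (a • v) = a • f v) ?_ hx hy ?_ ?_ a
    · intro c v
      simp [algebraMap_smul]
    · intro a b ha hb v
      rw [mul_smul, ha, hb, mul_smul]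
    · intro a b ha hb v
      rw [add_smul, map_add, ha, hb, add_smul]

/-- A `K`-subspace stable under `x` and `y` is an `R`-submodule. -/
def submoduleOfStable (U : Submodule K V) (hx : ∀ v ∈ U, x K • v ∈ U)
    (hy : ∀ v ∈ U, y K • v ∈ U) : Submodule (Alg K) V where
  carrier := U
  add_mem' := U.add_mem
  zero_mem' := U.zero_mem
  smul_mem' a := by
    suffices h : ∀ v, v ∈ U → a • v ∈ U from fun {v} => h v
    refine alg_induction (p := fun a => ∀ v, v ∈ U → a • v ∈ U) ?_ (fun v => hx v)
      (fun v => hy v) ?_ ?_ a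
    · intro c v hv
      simpa [algebraMap_smul] using U.smul_mem c hv
    · intro a b ha hb v hv
      rw [mul_smul]; exact ha _ (hb _ hv)
    · intro a b ha hb v hv
      rw [add_smul]; exact U.add_mem (ha _ hv) (hb _ hv)

end Linear

section Module

variable {V : Type*} [AddCommGroup V] [Module (Alg K) V]

theorem e_smul (v : V) : e K • v = v - y K • x K • v := by
  rw [e, sub_smul, one_smul, mul_smul]

theorem x_smul_y_smul (v : V) : x K • y K • v = v := by
  rw [← mul_smul, x_mul_y, one_smul]

theorem y_smul_x_smul (v : V) : y K • x K • v = v - e K • v := by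
  rw [e_smul]; simp

end Module

variable (K)

/-- The module of sequences in `K`, on which `x` acts by the left shift and `y` by the right shift.
-/
def Seq (K : Type u) : Type u := ℕ → K

instance : AddCommGroup (Seq K) := inferInstanceAs (AddCommGroup (ℕ → K))
instance : Module K (Seq K) := inferInstanceAs (Module K (ℕ → K))

/-- The left shift. -/
def leftShift : Seq K →ₗ[K] Seq K where
  toFun f i := f (i + 1)
  map_add' _ _ := rfl
  map_smul' _ _ := rfl

/-- The right shift. -/
def rightShift : Seq K →ₗ[K] Seq K where
  toFun f i := Nat.casesOn i 0 (fun i => f i)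
  map_add' f g := by
    funext i
    cases i
    · exact (add_zero (0 : K)).symm
    · rfl
  map_smul' c f := by
    funext i
    cases i
    · exact (mul_zero c).symm
    · rfl

/-- The action of `R` on sequences. -/
noncomputable def shiftRep : Alg K →ₐ[K] Module.End K (Seq K) :=
  RingQuot.liftAlgHom K ⟨FreeAlgebra.lift K ![leftShift K, rightShift K], by
    rintro _ _ ⟨⟩
    simp only [map_mul, FreeAlgebra.lift_ι_apply, map_one]
    rfl⟩

noncomputable instance : Module (Alg K) (Seq K) :=
  Module.compHom (Seq K) (shiftRep K).toRingHom

instance : IsScalarTower K (Alg K) (Seq K) where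
  smul_assoc c a f := by
    change shiftRep K (c • a) f = c • shiftRep K a f
    simp

variable {K}

@[simp]
theorem Seq.add_apply (f g : Seq K) (i : ℕ) : (f + g) i = f i + g i := rfl

@[simp]
theorem Seq.sub_apply (f g : Seq K) (i : ℕ) : (f - g) i = f i - g i := rfl

@[simp]
theorem Seq.smul_apply (c : K) (f : Seq K) (i : ℕ) : (c • f) i = c * f i := rfl

@[simp]
theorem Seq.zero_apply (i : ℕ) : (0 : Seq K) i = 0 := rfl

@[simp]
theorem x_smul_seq (f : Seq K) (i : ℕ) : (x K • f) i = f (i + 1) := by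
  change shiftRep K (x K) f i = _
  simp [shiftRep, x]; rfl

@[simp]
theorem y_smul_seq_zero (f : Seq K) : (y K • f) 0 = 0 := by
  change shiftRep K (y K) f 0 = _
  simp [shiftRep, y]; rfl

@[simp]
theorem y_smul_seq_succ (f : Seq K) (i : ℕ) : (y K • f) (i + 1) = f i := by
  change shiftRep K (y K) f (i + 1) = _
  simp [shiftRep, y]; rfl

@[simp]
theorem x_pow_smul_seq (f : Seq K) (n i : ℕ) : (x K ^ n • f) i = f (i + n) := by
  induction n generalizing i with
  | zero => simp
  | succ n ih => rw [pow_succ', mul_smul, x_smul_seq, ih]; congr 1; omega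

theorem e_smul_seq_zero (f : Seq K) : (e K • f) 0 = f 0 := by
  rw [e_smul]; simp

theorem e_smul_seq_succ (f : Seq K) (i : ℕ) : (e K • f) (i + 1) = 0 := by
  rw [e_smul]; simp

end Algebra

/-! ### The simple projective module of finitely supported sequences. -/

section SimpleModule

variable {K : Type u} [Field K]

theorem mem_S₁_iff {a : Alg K} : a ∈ S₁ K ↔ a * e K = a := by
  rw [S₁, Ideal.mem_span_singleton']
  constructor
  · rintro ⟨b, rfl⟩
    exact (mul_assoc _ _ _).trans (congrArg (b * ·) (e_mul_e K))
  · intro h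
    exact ⟨a, h⟩

variable (K) in
/-- The generator `e` of `S₁`. -/
noncomputable def gen : S₁ K := ⟨e K, mem_S₁_iff.2 (e_mul_e K)⟩

theorem smul_gen (a : S₁ K) : (a : Alg K) • gen K = a :=
  Subtype.ext (mem_S₁_iff.1 a.2)

/-- The homomorphism `S₁ → M`, `a ↦ a m`. -/
noncomputable def ofElement {M : Type*} [AddCommGroup M] [Module (Alg K) M] (m : M) :
    S₁ K →ₗ[Alg K] M :=
  LinearMap.toSpanSingleton (Alg K) M m ∘ₗ (S₁ K).subtype

@[simp]
theorem ofElement_apply {M : Type*} [AddCommGroup M] [Module (Alg K) M] (m : M) (a : S₁ K) :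
    ofElement m a = (a : Alg K) • m := rfl

open Polynomial in
-- The elements `p(y)e` are stable under left multiplication: `y` multiplies `p` by `X`, while `xy =
-- 1` and `xe = 0` make `x` act as `divX`.
theorem exists_polynomial_of_mem_S₁ {a : Alg K} (ha : a ∈ S₁ K) :
    ∃ p : K[X], a = aeval (y K) p * e K := by
  let U : Submodule K (Alg K) :=
    LinearMap.range (LinearMap.mulRight K (e K) ∘ₗ (aeval (y K)).toLinearMap)
  have hU (b : Alg K) : b ∈ U ↔ ∃ p : K[X], aeval (y K) p * e K = b := Iff.rfl
  let N : Submodule (Alg K) (Alg K) := submoduleOfStable U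
    (by
      intro v hv
      obtain ⟨p, rfl⟩ := (hU v).1 hv
      refine (hU _).2 ⟨p.divX, ?_⟩
      conv_rhs => rw [← p.X_mul_divX_add]
      simp only [map_add, map_mul, aeval_X, aeval_C, smul_eq_mul, add_mul, mul_add]
      rw [Algebra.commutes (p.coeff 0) (e K), ← mul_assoc (x K) (e K), x_mul_e, zero_mul,
        add_zero, ← mul_assoc, ← mul_assoc, x_mul_y, one_mul])
    (by
      intro v hv
      obtain ⟨p, rfl⟩ := (hU v).1 hv
      exact (hU _).2 ⟨X * p, by simp [mul_assoc]⟩)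
  have he : e K ∈ N := (hU _).2 ⟨1, by simp⟩
  have : S₁ K ≤ N := (Ideal.span_singleton_le_iff_mem N).2 he
  obtain ⟨p, hp⟩ := (hU a).1 (this ha)
  exact ⟨p, hp.symm⟩

/-- The sequence `(1, 0, 0, …)`. -/
def delta : Seq K := fun i => if i = 0 then 1 else 0

theorem e_smul_delta : e K • (delta : Seq K) = delta := by
  funext i
  cases i with
  | zero => rw [e_smul_seq_zero]
  | succ i => rw [e_smul_seq_succ]; simp [delta]

open Polynomial in
theorem aeval_smul_delta (p : K[X]) (i : ℕ) : (aeval (y K) p • (delta : Seq K)) i = p.coeff i := by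
  induction p using Polynomial.induction_on generalizing i with
  | C c =>
    rw [aeval_C, algebraMap_smul, Seq.smul_apply, coeff_C, delta]
    split_ifs <;> simp
  | add p q hp hq => simp [add_smul, hp, hq]
  | monomial n c h =>
    rw [pow_succ, ← mul_assoc, mul_comm, map_mul, mul_smul, aeval_X]
    cases i with
    | zero => simp
    | succ i => rw [y_smul_seq_succ, h, coeff_X_mul]

variable (K) in
/-- The embedding of `S₁` into the module of sequences. -/
noncomputable def toSeq : S₁ K →ₗ[Alg K] Seq K := ofElement delta

@[simp]
theorem toSeq_gen : toSeq K (gen K) = delta := e_smul_delta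

open Polynomial in
theorem toSeq_injective : Function.Injective (toSeq K) := by
  rw [injective_iff_map_eq_zero]
  rintro ⟨a, ha⟩ h
  obtain ⟨p, rfl⟩ := exists_polynomial_of_mem_S₁ ha
  have hp : p = 0 := by
    ext i
    have := congrFun h i
    rwa [toSeq, ofElement_apply, mul_smul, e_smul_delta, aeval_smul_delta] at this
  simp [hp]

open Polynomial in
-- The sequence attached to `p(y)e` lists the coefficients of `p`.
theorem mem_range_toSeq_iff (f : Seq K) :
    f ∈ LinearMap.range (toSeq K) ↔ ∃ N, ∀ i, N ≤ i → f i = 0 := by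
  constructor
  · rintro ⟨⟨a, ha⟩, rfl⟩
    obtain ⟨p, rfl⟩ := exists_polynomial_of_mem_S₁ ha
    refine ⟨p.natDegree + 1, fun i hi => ?_⟩
    rw [toSeq, ofElement_apply, mul_smul, e_smul_delta, aeval_smul_delta]
    exact coeff_eq_zero_of_natDegree_lt hi
  · rintro ⟨N, hN⟩
    let p : K[X] := ∑ i ∈ Finset.range N, monomial i (f i)
    refine ⟨⟨aeval (y K) p * e K, ?_⟩, ?_⟩
    · rw [mem_S₁_iff, mul_assoc, e_mul_e]
    · funext i
      rw [toSeq, ofElement_apply, mul_smul, e_smul_delta, aeval_smul_delta]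
      simp only [p, finsetSum_coeff, coeff_monomial]
      refine (Finset.sum_ite_eq' (Finset.range N) i f).trans ?_
      split_ifs with h
      · rfl
      · exact (hN i (not_lt.1 fun h' => h (Finset.mem_range.2 h'))).symm

/-- `xⁿ` moves the `n`th entry to position zero and `e` erases all others, so `exⁿ` extracts
coefficients. Both simplicity of `S₁` and the decomposition of `IM` use this. -/
theorem e_smul_x_pow_smul (a : S₁ K) (n : ℕ) : e K • x K ^ n • a = toSeq K a n • gen K := by
  apply toSeq_injective
  rw [← algebraMap_smul (Alg K) (toSeq K a n) (gen K)]
  simp only [map_smul, toSeq_gen]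
  rw [algebraMap_smul]
  funext i
  cases i with
  | zero => rw [e_smul_seq_zero]; simp [delta]
  | succ i => rw [e_smul_seq_succ]; simp [delta]

theorem gen_ne_zero : gen K ≠ 0 := by
  intro h
  have := congrFun (congrArg (toSeq K) h) 0
  simp [delta] at this

instance : IsSimpleModule (Alg K) (S₁ K) := by
  rw [isSimpleModule_iff_toSpanSingleton_surjective]
  refine ⟨⟨gen K, 0, gen_ne_zero⟩, fun a ha b => ?_⟩
  obtain ⟨n, hn⟩ : ∃ n, toSeq K a n ≠ 0 := by
    by_contra! h
    exact ha (toSeq_injective ((funext h).trans (map_zero (toSeq K)).symm))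
  have he := e_smul_x_pow_smul a n
  generalize toSeq K a n = c at hn he
  -- Here `exⁿa = ce` with `c ≠ 0`; rescaling recovers the generator, which `b` carries to itself.
  refine ⟨(b : Alg K) * algebraMap K (Alg K) c⁻¹ * e K * x K ^ n, ?_⟩
  rw [LinearMap.toSpanSingleton_apply, mul_smul, mul_smul, he, mul_smul,
    algebraMap_smul]
  refine (congrArg _ (inv_smul_smul₀ hn (gen K))).trans ?_
  exact smul_gen b

/-- Right multiplication by the idempotent `e` retracts `R` onto `S₁`. -/
instance : Module.Projective (Alg K) (S₁ K) := by
  refine Module.Projective.of_split (S₁ K).subtype (LinearMap.toSpanSingleton (Alg K) _ (gen K)) ?_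
  ext a
  simp [smul_gen]

/-- Every nonzero homomorphism to `S₁` is a split epimorphism. -/
theorem exists_section_of_ne_zero {M : Type*} [AddCommGroup M] [Module (Alg K) M]
    {f : M →ₗ[Alg K] S₁ K} (hf : f ≠ 0) : ∃ g : S₁ K →ₗ[Alg K] M, f ∘ₗ g = LinearMap.id :=
  Module.projective_lifting_property f LinearMap.id
    (LinearMap.surjective_of_ne_zero (R := Alg K) (M := M) (N := S₁ K) hf)

end SimpleModule

/-! ### The ideal `I` and the corner `eM`. -/

section Corner

variable {K : Type u} [Field K] {M : Type*} [AddCommGroup M] [Module (Alg K) M]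

theorem e_smul_mem_IM {M : Type u} [AddCommGroup M] [Module (Alg K) M] (m : M) :
    e K • m ∈ IM K M :=
  Submodule.smul_mem_smul (TwoSidedIdeal.mem_asIdeal.2 (TwoSidedIdeal.subset_span rfl))
    Submodule.mem_top

/-- The set of `a` with `aM ⊆ N` is a two-sided ideal, so it contains `I` once it contains `e`. -/
theorem IM_le_of_e_smul_mem {M : Type u} [AddCommGroup M] [Module (Alg K) M]
    {N : Submodule (Alg K) M} (h : ∀ m : M, e K • m ∈ N) : IM K M ≤ N := by
  let J : TwoSidedIdeal (Alg K) := TwoSidedIdeal.mk' {a | ∀ m : M, a • m ∈ N}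
    (fun m => by simp)
    (fun ha hb m => by rw [add_smul]; exact N.add_mem (ha m) (hb m))
    (fun ha m => by rw [neg_smul]; exact N.neg_mem (ha m))
    (fun hb m => by rw [mul_smul]; exact N.smul_mem _ (hb m))
    (fun ha m => by rw [mul_smul]; exact ha _)
  have hJ : TwoSidedIdeal.span {1 - y K * x K} ≤ J := by
    rw [TwoSidedIdeal.span_le, Set.singleton_subset_iff]
    exact (TwoSidedIdeal.mem_mk' _ _ _ _ _ _ _).2 h
  refine Submodule.smul_le.2 fun a ha m _ => ?_
  exact (TwoSidedIdeal.mem_mk' _ _ _ _ _ _ _).1 (hJ (TwoSidedIdeal.mem_asIdeal.1 ha)) m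

variable [Module K M] [IsScalarTower K (Alg K) M]

variable (K M) in
/-- The `K`-subspace `eM` of `M`. -/
noncomputable def corner : Submodule K M :=
  LinearMap.range (Algebra.lsmul K K M (e K))

theorem e_smul_mem_corner (m : M) : e K • m ∈ corner K M := ⟨m, rfl⟩

theorem e_smul_of_mem_corner {m : M} (hm : m ∈ corner K M) : e K • m = m := by
  obtain ⟨n, rfl⟩ := hm
  change e K • e K • n = e K • n
  rw [← mul_smul, e_mul_e]

/-- For `m` in `eM` and `a` in `S₁`, the element `e xⁿ a m` is a multiple of `m`. -/
theorem e_smul_x_pow_smul_smul {m : M} (hm : m ∈ corner K M) (a : S₁ K) (n : ℕ) :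
    e K • x K ^ n • (a : Alg K) • m = toSeq K a n • m := by
  have h := congrArg (fun b : S₁ K => (b : Alg K) • m) (e_smul_x_pow_smul a n)
  have h' : (e K • x K ^ n • a : S₁ K).1 = e K * (x K ^ n * a.1) := rfl
  generalize toSeq K a n = c at h ⊢
  have h'' : (c • gen K : S₁ K).1 = c • e K := rfl
  simp only [h', h'', mul_smul, smul_assoc] at h
  rwa [e_smul_of_mem_corner hm] at h

end Corner

/-! ### The length of `IM` as the dimension of `eM`. -/

section Length

/-- The length of a submodule that is an internal direct sum of copies of `S`. -/
theorem length_eq_card_mul {R S M ι : Type*} [Ring R] [AddCommGroup S] [Module R S]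
    [AddCommGroup M] [Module R M] (f : ι → S →ₗ[R] M) {N : Submodule R M}
    (hf : ∀ (t : Finset ι) (a : ι → S), ∑ i ∈ t, f i (a i) = 0 → ∀ i ∈ t, a i = 0)
    (hN : ∀ i a, f i a ∈ N) (hN' : N ≤ ⨆ i, LinearMap.range (f i)) :
    Module.length R N = ENat.card ι * Module.length R S := by
  let F : (ι →₀ S) →ₗ[R] M := Finsupp.lsum ℕ f
  have hF (s : ι →₀ S) : F s = ∑ i ∈ s.support, f i (s i) := by
    simp [F, Finsupp.sum]
  have hinj : Function.Injective F := by
    rw [injective_iff_map_eq_zero]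
    intro s hs
    ext i
    by_contra hi
    exact hi (hf s.support s (hF s ▸ hs) i (Finsupp.mem_support_iff.2 hi))
  have hrange : LinearMap.range F = N := by
    apply le_antisymm
    · rintro _ ⟨s, rfl⟩
      rw [hF]
      exact Submodule.sum_mem _ fun i _ => hN i _
    · refine hN'.trans (iSup_le fun i => ?_)
      rintro _ ⟨a, rfl⟩
      exact ⟨Finsupp.single i a, by simp [F]⟩
  rw [← Module.length_finsupp, (LinearEquiv.ofInjective F hinj).length_eq, hrange]

variable {K : Type u} [Field K] {M : Type u} [AddCommGroup M] [Module (Alg K) M]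

theorem length_IM_ne_top (hM : IsFiniteLength (Alg K) M) :
    Module.length (Alg K) (IM K M) ≠ ⊤ :=
  Module.length_ne_top_iff.2 (hM.of_injective (f := (IM K M).subtype) Subtype.val_injective)

variable [Module K M] [IsScalarTower K (Alg K) M]

/-- Each basis vector of `eM` generates a copy of `S₁`. Applying `exⁿ` to a relation between these
copies gives a linear relation between the basis vectors themselves, so the sum is direct; it is all
of `IM` because it contains `eM`. -/
theorem length_IM_eq_card {ι : Type*} (b : Module.Basis ι K (corner K M)) :
    Module.length (Alg K) (IM K M) = ENat.card ι := by
  rw [length_eq_card_mul (R := Alg K) (S := S₁ K) (N := IM K M) (fun i => ofElement (b i : M)),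
    Module.length_eq_one, mul_one]
  · intro t a h i hi
    apply toSeq_injective
    rw [map_zero]
    funext n
    refine linearIndependent_iff'.1 b.linearIndependent t (fun i => toSeq K (a i) n) ?_ i hi
    have h := congrArg (fun m : M => e K • x K ^ n • m) h
    simp only [smul_zero, Finset.smul_sum, ofElement_apply] at h
    apply Subtype.ext
    rw [ZeroMemClass.coe_zero, ← h, AddSubmonoidClass.coe_finsetSum]
    exact Finset.sum_congr rfl fun i _ => (e_smul_x_pow_smul_smul (b i).2 (a i) n).symm
  · intro i a
    rw [ofElement_apply, ← e_smul_of_mem_corner (b i).2]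
    exact Submodule.smul_mem _ _ (e_smul_mem_IM _)
  · refine IM_le_of_e_smul_mem fun m => ?_
    have h := congrArg Subtype.val (b.linearCombination_repr ⟨e K • m, e_smul_mem_corner m⟩)
    rw [Finsupp.linearCombination_apply, Finsupp.sum, AddSubmonoidClass.coe_finsetSum] at h
    change _ = e K • m at h
    rw [← h]
    refine Submodule.sum_mem _ fun i _ => ?_
    rw [SetLike.val_smul, ← algebraMap_smul (Alg K)]
    exact Submodule.smul_mem _ _
      (Submodule.mem_iSup_of_mem i ⟨gen K, e_smul_of_mem_corner (b i).2⟩)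

theorem finite_corner (hM : IsFiniteLength (Alg K) M) : Module.Finite K (corner K M) := by
  let b := Module.Basis.ofVectorSpace K (corner K M)
  have h := length_IM_ne_top hM
  rw [length_IM_eq_card b, ne_eq, ENat.card_eq_top, not_infinite_iff_finite] at h
  exact Module.Finite.of_basis b

theorem finrank_corner (hM : IsFiniteLength (Alg K) M) :
    Module.finrank K (corner K M) = (Module.length (Alg K) (IM K M)).toNat := by
  have := finite_corner hM
  rw [length_IM_eq_card (Module.finBasis K (corner K M))]
  simp

end Length

/-! ### Homomorphisms into the sequence module. -/

section Hom

variable {K : Type u} [Field K] {M : Type*} [AddCommGroup M] [Module (Alg K) M]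
  [Module K M] [IsScalarTower K (Alg K) M]

/-- The homomorphism to sequences defined by a functional vanishing on `yM`. -/
noncomputable def homOfFunctional (ψ : M →ₗ[K] K) (h : ∀ m, ψ (y K • m) = 0) :
    M →ₗ[Alg K] Seq K :=
  linearMapOfCommutes
    { toFun m := fun i => ψ (x K ^ i • m)
      map_add' m n := by
        funext i
        exact (congrArg ψ (smul_add _ _ _)).trans (map_add ψ _ _)
      map_smul' c m := by
        funext i
        exact (congrArg ψ (smul_comm _ _ _)).trans (map_smul ψ _ _) }
    (fun m => by
      funext i
      rw [x_smul_seq]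
      change ψ (x K ^ i • x K • m) = ψ (x K ^ (i + 1) • m)
      rw [pow_succ, mul_smul])
    (fun m => by
      funext i
      cases i with
      | zero =>
        rw [y_smul_seq_zero]
        change ψ (x K ^ 0 • y K • m) = 0
        rw [pow_zero, one_smul, h]
      | succ i =>
        rw [y_smul_seq_succ]
        change ψ (x K ^ (i + 1) • y K • m) = ψ (x K ^ i • m)
        rw [pow_succ, mul_smul, x_smul_y_smul])

theorem homOfFunctional_apply (ψ : M →ₗ[K] K) (h) (m : M) (i : ℕ) :
    homOfFunctional ψ h m i = ψ (x K ^ i • m) := rfl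

omit [Module K M] [IsScalarTower K (Alg K) M] in
theorem hom_seq_apply (f : M →ₗ[Alg K] Seq K) (m : M) (i : ℕ) :
    f m i = f (x K ^ i • m) 0 := by
  rw [map_smul, x_pow_smul_seq, zero_add]

omit [Module K M] [IsScalarTower K (Alg K) M] in
theorem hom_seq_e_smul (f : M →ₗ[Alg K] Seq K) (m : M) : f (e K • m) 0 = f m 0 := by
  rw [map_smul, e_smul_seq_zero]

variable (K) in
/-- The functional `f ↦ f 0` on sequences. -/
def evalZero : Seq K →ₗ[K] K where
  toFun f := f 0
  map_add' _ _ := rfl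
  map_smul' _ _ := rfl

/-- `K`-linearity of `R`-linear maps. -/
def restrictK {N : Type*} [AddCommGroup N] [Module (Alg K) N] [Module K N]
    [IsScalarTower K (Alg K) N] (f : M →ₗ[Alg K] N) : M →ₗ[K] N :=
  { f with
    map_smul' := fun c m => by
      change f (c • m) = c • f m
      rw [← algebraMap_smul (Alg K) c m, ← algebraMap_smul (Alg K) c (f m)]
      exact f.map_smul _ m }

@[simp]
theorem restrictK_apply {N : Type*} [AddCommGroup N] [Module (Alg K) N] [Module K N]
    [IsScalarTower K (Alg K) N] (f : M →ₗ[Alg K] N) (m : M) : restrictK f m = f m := rfl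

variable (K M) in
/-- Homomorphisms to the module of sequences are functionals on `eM`. -/
noncomputable def homSeqEquiv : (M →ₗ[Alg K] Seq K) ≃ₗ[K] Module.Dual K (corner K M) :=
  LinearEquiv.ofBijective
    { toFun f := evalZero K ∘ₗ restrictK f ∘ₗ (corner K M).subtype
      map_add' f g := rfl
      map_smul' c f := rfl }
    (by
      constructor
      · intro f g hf
        ext m
        funext i
        rw [hom_seq_apply, ← hom_seq_e_smul, hom_seq_apply g, ← hom_seq_e_smul g]
        exact LinearMap.congr_fun hf ⟨e K • x K ^ i • m, e_smul_mem_corner _⟩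
      · intro φ
        -- Extending `φ` by `m ↦ φ(em)` makes it vanish on `yM`, because `ey = 0`.
        let ψ : M →ₗ[K] K := φ ∘ₗ (Algebra.lsmul K K M (e K)).rangeRestrict
        have hψ (m : M) : ψ m = φ ⟨e K • m, e_smul_mem_corner m⟩ := rfl
        refine ⟨homOfFunctional ψ fun m => ?_, ?_⟩
        · rw [hψ, ← map_zero φ]
          refine congrArg φ (Subtype.ext ?_)
          change e K • y K • m = 0
          rw [← mul_smul, e_mul_y, zero_smul]
        · ext m
          change ψ (x K ^ 0 • m) = φ m
          rw [hψ]
          refine congrArg φ (Subtype.ext ?_)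
          change e K • x K ^ 0 • (m : M) = m
          rw [pow_zero, one_smul, e_smul_of_mem_corner m.2])

end Hom

/-! ### Injectivity of the sequence module. -/

section Injective

variable {K : Type u} [Field K]

instance : Module.Injective (Alg K) (Seq K) where
  out X Y _ _ _ _ f hf g := by
    let _ : Module K X := Module.compHom X (algebraMap K (Alg K))
    let _ : Module K Y := Module.compHom Y (algebraMap K (Alg K))
    have _ : IsScalarTower K (Alg K) X := ⟨fun c a v => by
      rw [Algebra.smul_def, mul_smul]; rfl⟩
    have _ : IsScalarTower K (Alg K) Y := ⟨fun c a v => by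
      rw [Algebra.smul_def, mul_smul]; rfl⟩
    obtain ⟨r, hr⟩ := (restrictK f).exists_leftInverse_of_injective
      (LinearMap.ker_eq_bot.2 hf)
    -- The retraction `r` is only `K`-linear. Inserting `e` makes the functional vanish on `yY`,
    -- which is all that is needed to build an `R`-linear map, and does not change zeroth
    -- coordinates on the image of `f`.
    let ψ : Y →ₗ[K] K := evalZero K ∘ₗ restrictK g ∘ₗ r ∘ₗ Algebra.lsmul K K Y (e K)
    have hψ (m : Y) : ψ m = g (r (e K • m)) 0 := rfl
    refine ⟨homOfFunctional ψ fun m => ?_, fun m => ?_⟩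
    · rw [hψ, ← mul_smul, e_mul_y, zero_smul, map_zero, map_zero, Seq.zero_apply]
    · funext i
      rw [homOfFunctional_apply, hψ, ← map_smul f, ← map_smul f]
      have : r (f (e K • x K ^ i • m)) = e K • x K ^ i • m := LinearMap.congr_fun hr _
      rw [this, hom_seq_e_smul, ← hom_seq_apply]

end Injective

/-! ### Finite-length modules killed by `e` are finite dimensional. -/

section FiniteDimensional

variable {K : Type u} [Field K]

theorem lsmul_mem_adjoin {V : Type*} [AddCommGroup V] [Module (Alg K) V] [Module K V]
    [IsScalarTower K (Alg K) V] (a : Alg K) :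
    Algebra.lsmul K K V a ∈
      Algebra.adjoin K {Algebra.lsmul K K V (x K), Algebra.lsmul K K V (y K)} := by
  refine alg_induction (p := fun a => Algebra.lsmul K K V a ∈
    Algebra.adjoin K {Algebra.lsmul K K V (x K), Algebra.lsmul K K V (y K)}) ?_ ?_ ?_ ?_ ?_ a
  · intro c
    rw [AlgHom.commutes]
    exact Subalgebra.algebraMap_mem _ c
  · exact Algebra.subset_adjoin (Or.inl rfl)
  · exact Algebra.subset_adjoin (Or.inr rfl)
  · intro a b ha hb
    rw [map_mul]
    exact Subalgebra.mul_mem _ ha hb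
  · intro a b ha hb
    rw [map_add]
    exact Subalgebra.add_mem _ ha hb

/-- Zariski's lemma: the residue field of a finite type algebra at a maximal ideal is finite over
`K`. -/
theorem finite_of_isSimpleModule_of_finiteType (K : Type*) {A V : Type*} [Field K] [CommRing A]
    [Algebra K A] [Algebra.FiniteType K A] [AddCommGroup V] [Module A V] [Module K V]
    [IsScalarTower K A V] [h : IsSimpleModule A V] : Module.Finite K V := by
  obtain ⟨I, hI, ⟨f⟩⟩ := isSimpleModule_iff_quot_maximal.1 h
  let _ : Field (A ⧸ I) := Ideal.Quotient.field I
  have := finite_of_finite_type_of_isJacobsonRing K (A ⧸ I)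
  exact Module.Finite.equiv (f.restrictScalars K).symm

open scoped IsMulCommutative in
theorem finite_of_subalgebra {K V : Type*} [Field K] [AddCommGroup V] [Module K V] [Nontrivial V]
    (A : Subalgebra K (Module.End K V)) [IsMulCommutative A] [Algebra.FiniteType K A]
    (h : ∀ v : V, v ≠ 0 → ∀ w, ∃ a ∈ A, a v = w) : Module.Finite K V := by
  have : IsSimpleModule A V := by
    rw [isSimpleModule_iff_toSpanSingleton_surjective]
    refine ⟨inferInstance, fun v hv w => ?_⟩
    obtain ⟨a, ha, hw⟩ := h v hv w
    exact ⟨⟨a, ha⟩, hw⟩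
  exact finite_of_isSimpleModule_of_finiteType K (A := A)

theorem finite_of_commute {K V : Type*} [Field K] [AddCommGroup V] [Module K V] [Nontrivial V]
    {f g : Module.End K V} (hfg : f * g = g * f)
    (h : ∀ v : V, v ≠ 0 → ∀ w, ∃ a ∈ Algebra.adjoin K {f, g}, a v = w) : Module.Finite K V := by
  have hs : ∀ a ∈ ({f, g} : Set (Module.End K V)), ∀ b ∈ ({f, g} : Set (Module.End K V)),
      a * b = b * a := by
    rintro a (rfl | rfl) b (rfl | rfl)
    · rfl
    · exact hfg
    · exact hfg.symm
    · rfl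
  have := Algebra.isMulCommutative_adjoin K hs
  have : Algebra.FiniteType K (Algebra.adjoin K {f, g}) :=
    (Subalgebra.fg_iff_finiteType _).1 ⟨((Set.finite_singleton g).insert f).toFinset, by simp⟩
  exact finite_of_subalgebra _ h

/-- Simple `K[y, y⁻¹]`-modules are finite dimensional. -/
theorem finite_of_isSimpleModule {V : Type*} [AddCommGroup V] [Module (Alg K) V] [Module K V]
    [IsScalarTower K (Alg K) V] [IsSimpleModule (Alg K) V] (hV : ∀ v : V, e K • v = 0) :
    Module.Finite K V := by
  have := IsSimpleModule.nontrivial (Alg K) V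
  refine finite_of_commute (f := Algebra.lsmul K K V (x K)) (g := Algebra.lsmul K K V (y K)) ?_ ?_
  -- As `e` acts by zero, `yx` acts as the identity, just as `xy` does, so the two operators
  -- commute.
  · refine LinearMap.ext fun v => ?_
    change x K • y K • v = y K • x K • v
    rw [x_smul_y_smul, y_smul_x_smul, hV, sub_zero]
  · intro v hv w
    obtain ⟨a, ha⟩ := IsSimpleModule.toSpanSingleton_surjective (Alg K) hv w
    exact ⟨Algebra.lsmul K K V a, lsmul_mem_adjoin a, ha⟩

/-- Finite length `K[y, y⁻¹]`-modules are finite dimensional. -/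
theorem finite_of_isFiniteLength {V : Type*} [AddCommGroup V] [Module (Alg K) V] [Module K V]
    [IsScalarTower K (Alg K) V] (h : IsFiniteLength (Alg K) V) (hV : ∀ v : V, e K • v = 0) :
    Module.Finite K V := by
  -- The module varies along the composition series, so its `K`-structure and the vanishing of `e`
  -- must be generalized as well.
  revert hV
  revert ‹Module K V›
  induction h with
  | of_subsingleton =>
    intros
    infer_instance
  | @of_simple_quotient M _ _ N hN _ ih =>
    intro _ _ hM
    have h₁ : Module.Finite K N := ih fun v => Subtype.ext (hM v)
    have h₂ : Module.Finite K (M ⧸ N) := finite_of_isSimpleModule fun v => by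
      obtain ⟨m, rfl⟩ := N.mkQ_surjective v
      rw [← map_smul, hM, map_zero]
    have h₃ : Module.Finite K (N.restrictScalars K) := h₁
    have h₄ : Module.Finite K (M ⧸ N.restrictScalars K) := h₂
    exact Module.Finite.of_submodule_quotient (N.restrictScalars K)

end FiniteDimensional

/-! ### Germs at infinity and duality for modules killed by `e`. -/

section Cokernel

variable (K : Type u) [Field K]

/-- The module of sequences modulo finitely supported ones. -/
abbrev Germ : Type u := Seq K ⧸ LinearMap.range (toSeq K)

variable {K}

/-- The class of a sequence in the germ module. -/
noncomputable def germMk : Seq K →ₗ[Alg K] Germ K := Submodule.mkQ _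

theorem germMk_surjective : Function.Surjective (germMk (K := K)) := Submodule.mkQ_surjective _

theorem germMk_eq_zero_iff (f : Seq K) : germMk f = 0 ↔ ∃ N, ∀ i, N ≤ i → f i = 0 := by
  rw [germMk, Submodule.mkQ_apply, Submodule.Quotient.mk_eq_zero, mem_range_toSeq_iff]

theorem range_toSeq_eq_ker_germMk :
    LinearMap.range (toSeq K) = LinearMap.ker (germMk (K := K)) := by
  ext f
  rw [LinearMap.mem_ker, germMk_eq_zero_iff, mem_range_toSeq_iff]

theorem germMk_eq_iff (f g : Seq K) :
    germMk f = germMk g ↔ ∃ N, ∀ i, N ≤ i → f i = g i := by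
  rw [← sub_eq_zero, ← map_sub, germMk_eq_zero_iff]
  simp only [Seq.sub_apply, sub_eq_zero]

/-- The sequence `ef` is supported at position zero, hence has trivial germ. -/
theorem e_smul_germ (q : Germ K) : e K • q = 0 := by
  obtain ⟨f, rfl⟩ := germMk_surjective q
  rw [← map_smul, germMk_eq_zero_iff]
  refine ⟨1, fun i hi => ?_⟩
  obtain ⟨j, rfl⟩ := Nat.exists_eq_add_of_le' hi
  exact e_smul_seq_succ f j

variable {V : Type*} [AddCommGroup V] [Module K V]

/-- A linear map from a finite dimensional space to finitely supported sequences has image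
supported in a fixed finite interval. -/
theorem exists_uniform_bound [Module.Finite K V] (G : V →ₗ[K] Seq K)
    (hG : ∀ v, ∃ N, ∀ i, N ≤ i → G v i = 0) : ∃ N, ∀ v i, N ≤ i → G v i = 0 := by
  choose N hN using hG
  obtain ⟨s, hs⟩ := (Module.Finite.fg_top : (⊤ : Submodule K V).FG)
  refine ⟨s.sup N, fun v i hi => ?_⟩
  have hv : v ∈ Submodule.span K (s : Set V) := hs ▸ Submodule.mem_top
  induction hv using Submodule.span_induction with
  | mem w hw => exact hN w i ((Finset.le_sup hw).trans hi)
  | zero => rw [map_zero, Seq.zero_apply]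
  | add a b _ _ ha hb => rw [map_add, Seq.add_apply, ha, hb, add_zero]
  | smul c a _ ha => rw [map_smul, Seq.smul_apply, ha, mul_zero]

variable [Module (Alg K) V] [IsScalarTower K (Alg K) V]

omit [Module K V] [IsScalarTower K (Alg K) V] in
theorem y_pow_smul_x_pow_smul (hV : ∀ v : V, e K • v = 0) (n : ℕ) (v : V) :
    y K ^ n • x K ^ n • v = v := by
  induction n generalizing v with
  | zero => simp
  | succ n ih =>
    rw [pow_succ, pow_succ', mul_smul, mul_smul, y_smul_x_smul, hV, sub_zero, ih]

omit [Module K V] [IsScalarTower K (Alg K) V] in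
theorem x_pow_smul_y_pow_smul (n : ℕ) (v : V) : x K ^ n • y K ^ n • v = v := by
  rw [← mul_smul, x_pow_mul_y_pow, one_smul]

/-- The sequences of values of a functional along orbits of `x`. -/
noncomputable def orbitSeq (φ : V →ₗ[K] K) : V →ₗ[K] Seq K where
  toFun v := fun i => φ (x K ^ i • v)
  map_add' v w := by
    funext i
    exact (congrArg φ (smul_add _ _ _)).trans (map_add φ _ _)
  map_smul' c v := by
    funext i
    exact (congrArg φ (smul_comm _ _ _)).trans (map_smul φ _ _)

theorem orbitSeq_apply (φ : V →ₗ[K] K) (v : V) (i : ℕ) : orbitSeq φ v i = φ (x K ^ i • v) := rfl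

variable (K V) in
/-- For `V` annihilated by `e`, functionals on `V` define homomorphisms to the germ module. -/
noncomputable def dualToGerm :
    Module.Dual K V →ₗ[K] V →ₗ[Alg K] Germ K where
  toFun φ := linearMapOfCommutes (restrictK germMk ∘ₗ orbitSeq φ)
    (fun v => by
      simp only [LinearMap.comp_apply, restrictK_apply, ← map_smul]
      congr 1
      funext i
      rw [x_smul_seq, orbitSeq_apply, orbitSeq_apply, pow_succ, mul_smul])
    (fun v => by
      simp only [LinearMap.comp_apply, restrictK_apply]
      rw [← map_smul, germMk_eq_iff]
      refine ⟨1, fun i hi => ?_⟩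
      obtain ⟨j, rfl⟩ := Nat.exists_eq_add_of_le' hi
      rw [y_smul_seq_succ, orbitSeq_apply, orbitSeq_apply, pow_succ, mul_smul, x_smul_y_smul])
  map_add' φ ψ := rfl
  map_smul' c φ := by
    ext v
    change germMk (orbitSeq (c • φ) v) = c • germMk (orbitSeq φ v)
    rw [← restrictK_apply, ← restrictK_apply, ← map_smul]
    rfl

theorem dualToGerm_apply (φ : Module.Dual K V) (v : V) :
    dualToGerm K V φ v = germMk (orbitSeq φ v) := rfl

/-- On `V` the operators `x` and `y` are mutually inverse. Finite dimensionality makes "eventually"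
uniform in `v`, so a single shift by `N` passes every exceptional position. -/
theorem dualToGerm_bijective [Module.Finite K V] (hV : ∀ v : V, e K • v = 0) :
    Function.Bijective (dualToGerm K V) := by
  constructor
  · rw [injective_iff_map_eq_zero]
    intro φ hφ
    obtain ⟨N, hN⟩ := exists_uniform_bound (orbitSeq φ) fun v => by
      have h := LinearMap.congr_fun hφ v
      rwa [dualToGerm_apply, LinearMap.zero_apply, germMk_eq_zero_iff] at h
    ext v
    -- The orbit of `yᴺv` passes through `v` at time `N`, where the orbit sequence already vanishes.
    have h := hN (y K ^ N • v) N le_rfl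
    rwa [orbitSeq_apply, x_pow_smul_y_pow_smul] at h
  · intro g
    obtain ⟨s, hs⟩ := (restrictK (germMk (K := K))).exists_rightInverse_of_surjective
      (LinearMap.range_eq_top.2 germMk_surjective)
    let G : V →ₗ[K] Seq K := s ∘ₗ restrictK g
    have hG (v : V) : germMk (G v) = g v := LinearMap.congr_fun hs (g v)
    -- The `K`-linear lift `G` commutes with `x` only modulo finitely supported sequences; beyond a
    -- uniform `N` the defect vanishes.
    obtain ⟨N, hN⟩ := exists_uniform_bound
      (G ∘ₗ Algebra.lsmul K K V (x K) - Algebra.lsmul K K (Seq K) (x K) ∘ₗ G) fun v => by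
        have h : germMk (G (x K • v)) = germMk (x K • G v) := by
          rw [hG, map_smul, map_smul, hG]
        rw [germMk_eq_iff] at h
        obtain ⟨N, hN⟩ := h
        exact ⟨N, fun i hi => sub_eq_zero.2 (hN i hi)⟩
    have hstep (v : V) (i : ℕ) (hi : N ≤ i) : G (x K • v) i = G v (i + 1) := by
      have h := sub_eq_zero.1 (hN v i hi)
      exact h.trans (x_smul_seq _ _)
    have hpow (j : ℕ) (v : V) : G (x K ^ j • v) N = G v (N + j) := by
      induction j generalizing v with
      | zero => rw [pow_zero, one_smul, add_zero]
      | succ j ih => rw [pow_succ, mul_smul, ih, hstep _ _ (Nat.le_add_right N j), add_assoc]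
    -- The functional reads `G` at position `N`, where it already commutes with `x`, and `yᴺ`
    -- compensates for the shift: `φ(xᴺ⁺ʲv) = G(xʲv)_N = G(v)_{N+j}`.
    let φ : V →ₗ[K] K :=
      evalZero K ∘ₗ Algebra.lsmul K K (Seq K) (x K ^ N) ∘ₗ G ∘ₗ Algebra.lsmul K K V (y K ^ N)
    have hφ (v : V) : φ v = G (y K ^ N • v) N := by
      refine (x_pow_smul_seq (G (y K ^ N • v)) N 0).trans ?_
      rw [zero_add]
    refine ⟨φ, ?_⟩
    ext v
    rw [dualToGerm_apply, ← hG, germMk_eq_iff]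
    refine ⟨N, fun i hi => ?_⟩
    obtain ⟨j, rfl⟩ := Nat.exists_eq_add_of_le hi
    rw [orbitSeq_apply, hφ, pow_add, mul_smul, y_pow_smul_x_pow_smul hV, hpow]

end Cokernel

/-! ### Dimension counts for `Ext¹` in an abelian category. -/

section Homological

theorem finite_and_finrank_of_exact {K A B C D : Type*} [Field K] [AddCommGroup A] [Module K A]
    [AddCommGroup B] [Module K B] [AddCommGroup C] [Module K C] [AddCommGroup D] [Module K D]
    [Module.Finite K B] [Module.Finite K C] (f : A →ₗ[K] B) (g : B →ₗ[K] C) (h : C →ₗ[K] D)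
    (hf : Function.Injective f) (hfg : LinearMap.range f = LinearMap.ker g)
    (hgh : LinearMap.range g = LinearMap.ker h) (hh : Function.Surjective h) :
    Module.Finite K D ∧
      Module.finrank K D + Module.finrank K B = Module.finrank K C + Module.finrank K A := by
  refine ⟨Module.Finite.of_surjective h hh, ?_⟩
  have h₁ := LinearMap.finrank_range_add_finrank_ker g
  have h₂ := LinearMap.finrank_range_add_finrank_ker h
  rw [LinearMap.range_eq_top.2 hh, finrank_top] at h₂
  rw [← hfg, LinearMap.finrank_range_of_inj hf] at h₁
  rw [← hgh] at h₂
  omega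

open Abelian

variable {K : Type*} [Field K] {C : Type*} [Category C] [Abelian C] [Linear K C]

/-- The dimension of `Ext¹` computed from a short exact sequence with injective middle term. -/
theorem finite_and_finrank_ext [HasExt C] {S : ShortComplex C} (hS : S.ShortExact)
    [Injective S.X₂] (X : C) [Module.Finite K (X ⟶ S.X₂)] [Module.Finite K (X ⟶ S.X₃)] :
    Module.Finite K (Ext X S.X₁ 1) ∧
      Module.finrank K (Ext X S.X₁ 1) + Module.finrank K (X ⟶ S.X₂) =
        Module.finrank K (X ⟶ S.X₃) + Module.finrank K (X ⟶ S.X₁) := by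
  have := hS.mono_f
  let δ : (X ⟶ S.X₃) →ₗ[K] Ext X S.X₁ 1 :=
    (hS.extClass.postcompOfLinear K X (zero_add 1)) ∘ₗ Ext.linearEquiv₀.symm.toLinearMap
  have hδ (u : X ⟶ S.X₃) : δ u = (Ext.mk₀ u).comp hS.extClass (zero_add 1) := rfl
  refine finite_and_finrank_of_exact (Linear.rightComp K X S.f) (Linear.rightComp K X S.g) δ
    ?_ ?_ ?_ ?_
  · intro u v h
    exact (cancel_mono S.f).1 h
  · ext u
    constructor
    · rintro ⟨v, rfl⟩
      simp
    · intro hu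
      exact ⟨hS.exact.lift u hu, hS.exact.lift_f u hu⟩
  · ext u
    constructor
    · rintro ⟨v, rfl⟩
      rw [LinearMap.mem_ker, hδ, Linear.rightComp_apply, ← Ext.mk₀_comp_mk₀,
        Ext.comp_assoc_of_second_deg_zero, hS.comp_extClass, Ext.comp_zero]
    · intro hu
      obtain ⟨v, hv⟩ := Ext.covariant_sequence_exact₃ X hS (Ext.mk₀ u) (zero_add 1) hu
      obtain ⟨w, rfl⟩ := Ext.homEquiv₀.symm.surjective v
      refine ⟨w, ?_⟩
      rw [Ext.homEquiv₀_symm_apply, Ext.mk₀_comp_mk₀] at hv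
      exact Ext.homEquiv₀.symm.injective hv
  · intro w
    -- The image of `w` in `Ext¹` of the injective middle term is zero, so `w` comes from the
    -- connecting map.
    obtain ⟨v, hv⟩ := Ext.covariant_sequence_exact₁ X hS w (Ext.eq_zero_of_injective _) (zero_add 1)
    obtain ⟨u, rfl⟩ := Ext.homEquiv₀.symm.surjective v
    exact ⟨u, hv⟩

/-- A retract `Y` of `X` whose complementary idempotent factors through a projective has the same
`Ext¹`. -/
theorem finrank_ext_eq_of_retract [HasExt C] {X Y P : C} [Projective P] (p : X ⟶ Y) (s : Y ⟶ X)
    (r : X ⟶ P) (i : P ⟶ X) (hs : s ≫ p = 𝟙 Y) (hsum : r ≫ i + p ≫ s = 𝟙 X) (Z : C) :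
    Module.finrank K (Ext X Z 1) = Module.finrank K (Ext Y Z 1) := by
  refine LinearEquiv.finrank_eq <| LinearEquiv.ofLinearMap
    ((Ext.mk₀ s).precompOfLinear K Z (zero_add 1)) ((Ext.mk₀ p).precompOfLinear K Z (zero_add 1))
    ?_ ?_
  · ext w
    simp only [LinearMap.comp_apply, Ext.bilinearCompOfLinear_apply_apply]
    rw [Ext.mk₀_comp_mk₀_assoc, hs, Ext.mk₀_id_comp, LinearMap.id_apply]
  · ext w
    -- In this decomposition of the identity, the summand through `P` contributes nothing because
    -- `Ext¹(P, Z) = 0`.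
    have h : (Ext.mk₀ (r ≫ i + p ≫ s)).comp w (zero_add 1) = w := by simp [hsum]
    rw [Ext.mk₀_add, Ext.add_comp, ← Ext.mk₀_comp_mk₀_assoc,
      Ext.eq_zero_of_projective ((Ext.mk₀ i).comp w _), Ext.comp_zero, zero_add] at h
    simpa using h

end Homological

/-! ### Coresolutions, splittings and direct summands of modules. -/

section Modules

variable {R : Type u} [Ring R]

theorem projective_pi_of_finite {ι S : Type*} [Finite ι] [AddCommGroup S] [Module R S]
    [Module.Projective R S] : Module.Projective R (ι → S) := by
  have := Fintype.ofFinite ι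
  exact Module.Projective.of_equiv (DFinsupp.linearEquivFunOnFintype (R := R) (M := fun _ : ι => S))

/-- The dimension of `Ext¹` into a power of `A`, from an injective coresolution of length one. -/
theorem finite_and_finrank_ext_pi {K : Type*} [Field K] [Linear K (ModuleCat.{u} R)]
    {A B C : Type u} [AddCommGroup A] [Module R A] [AddCommGroup B] [Module R B]
    [AddCommGroup C] [Module R C] [Module.Injective R B] {i : A →ₗ[R] B} {p : B →ₗ[R] C}
    (hi : Function.Injective i) (hip : LinearMap.range i = LinearMap.ker p)
    (hp : Function.Surjective p) (X : ModuleCat.{u} R) (k : ℕ)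
    (hB : Module.Finite K (X ⟶ ModuleCat.of R (Fin k → B)))
    (hC : Module.Finite K (X ⟶ ModuleCat.of R (Fin k → C))) :
    Module.Finite K (Abelian.Ext.{u} X (ModuleCat.of R (Fin k → A)) 1) ∧
      (Subsingleton (X ⟶ ModuleCat.of R (Fin k → A)) →
        Module.finrank K (Abelian.Ext.{u} X (ModuleCat.of R (Fin k → A)) 1) +
          Module.finrank K (X ⟶ ModuleCat.of R (Fin k → B)) =
        Module.finrank K (X ⟶ ModuleCat.of R (Fin k → C))) := by
  let S : ShortComplex (ModuleCat.{u} R) :=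
    ShortComplex.moduleCatMk (i.compLeft (Fin k)) (p.compLeft (Fin k)) (by
      refine LinearMap.ext fun s => funext fun j => ?_
      exact (hip ▸ LinearMap.mem_range_self i (s j) : i (s j) ∈ LinearMap.ker p))
  have hS : S.ShortExact :=
    { exact := by
        rw [ShortComplex.moduleCat_exact_iff]
        intro (s : Fin k → B) hs
        have h (j : Fin k) : s j ∈ LinearMap.range i := hip ▸ congrFun hs j
        choose a ha using h
        exact ⟨(a : Fin k → A), funext ha⟩
      mono_f := (ModuleCat.mono_iff_injective _).2 fun s t h =>
        funext fun j => hi (congrFun h j)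
      epi_g := (ModuleCat.epi_iff_surjective _).2 fun (q : Fin k → C) => by
        choose s hs using fun j => hp (q j)
        exact ⟨(s : Fin k → B), funext hs⟩ }
  have : Injective S.X₂ := Module.injective_object_of_injective_module R (Fin k → B)
  have : Module.Finite K (X ⟶ S.X₂) := hB
  have : Module.Finite K (X ⟶ S.X₃) := hC
  obtain ⟨h₁, h₂⟩ := finite_and_finrank_ext (K := K) hS X
  refine ⟨h₁, fun (h : Subsingleton (X ⟶ S.X₁)) => ?_⟩
  rwa [Module.finrank_zero_of_subsingleton (M := X ⟶ S.X₁), add_zero] at h₂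

variable {M X : Type*} [AddCommGroup M] [Module R M] [AddCommGroup X] [Module R X]

theorem isCompl_range_ker {f : M →ₗ[R] X} {g : X →ₗ[R] M} (h : f ∘ₗ g = LinearMap.id) :
    IsCompl (LinearMap.range g) (LinearMap.ker f) := by
  have h' (a : X) : f (g a) = a := LinearMap.congr_fun h a
  constructor
  · rw [Submodule.disjoint_def]
    rintro _ ⟨a, rfl⟩ ha
    rw [LinearMap.mem_ker, h'] at ha
    rw [ha, map_zero]
  · rw [codisjoint_iff, eq_top_iff]
    intro m _
    refine Submodule.mem_sup.2 ⟨g (f m), ⟨_, rfl⟩, m - g (f m), ?_, by abel⟩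
    rw [LinearMap.mem_ker, map_sub, h', sub_self]

theorem exists_isCompl_of_retract {f : M →ₗ[R] X} {g : X →ₗ[R] M} (h : f ∘ₗ g = LinearMap.id) :
    ∃ N M' : Submodule R M, IsCompl N M' ∧ Nonempty (N ≃ₗ[R] X) :=
  ⟨_, _, isCompl_range_ker h, ⟨(LinearEquiv.ofInjective g
    (Function.LeftInverse.injective (g := f) (LinearMap.congr_fun h))).symm⟩⟩

/-- A complemented submodule splits off. -/
theorem exists_splitting {N M' : Submodule R M} (h : IsCompl N M') :
    ∃ (r : M →ₗ[R] N) (s : (M ⧸ N) →ₗ[R] M), r ∘ₗ N.subtype = LinearMap.id ∧ r ∘ₗ s = 0 ∧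
      N.mkQ ∘ₗ s = LinearMap.id ∧ N.subtype ∘ₗ r + s ∘ₗ N.mkQ = LinearMap.id := by
  obtain ⟨r, hr⟩ : ∃ r : M →ₗ[R] N, r ∘ₗ N.subtype = LinearMap.id :=
    ⟨N.projectionOnto M' h, LinearMap.ext fun n => Submodule.projectionOnto_apply_left h n⟩
  have hr' (n : N) : r n = n := LinearMap.congr_fun hr n
  let s : (M ⧸ N) →ₗ[R] M := N.liftQ (LinearMap.id - N.subtype ∘ₗ r) fun n hn => by
    rw [LinearMap.mem_ker]
    change n - (r n : M) = 0
    rw [hr' ⟨n, hn⟩, sub_self]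
  have hs (m : M) : s (N.mkQ m) = m - r m := rfl
  refine ⟨r, s, hr, ?_, ?_, ?_⟩
  · refine Submodule.linearMap_qext _ (LinearMap.ext fun m => ?_)
    change r (m - r m) = 0
    rw [map_sub, hr', sub_self]
  · refine Submodule.linearMap_qext _ (LinearMap.ext fun m => ?_)
    change N.mkQ (m - r m) = N.mkQ m
    rw [map_sub, Submodule.mkQ_apply _ (r m : M), (Submodule.Quotient.mk_eq_zero N).2 (r m).2,
      sub_zero]
  · refine LinearMap.ext fun m => ?_
    change (r m : M) + (m - r m) = m
    abel

/-- A summand of the quotient by a summand yields a larger summand. -/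
theorem exists_isCompl_of_quotient {N M' : Submodule R M} (h : IsCompl N M')
    {L L' : Submodule R (M ⧸ N)} (h' : IsCompl L L') :
    ∃ P P' : Submodule R M, IsCompl P P' ∧ Nonempty (P ≃ₗ[R] L × N) := by
  obtain ⟨r, s, hrN, hrs, hs, -⟩ := exists_splitting h
  obtain ⟨q, t, hq, -⟩ := exists_splitting h'
  refine exists_isCompl_of_retract (f := (q ∘ₗ N.mkQ).prod r)
    (g := (s ∘ₗ L.subtype).coprod N.subtype) ?_
  refine LinearMap.ext fun ⟨a, n⟩ => ?_
  have h₁ : N.mkQ (s a) = a := LinearMap.congr_fun hs a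
  have h₂ : q a = a := LinearMap.congr_fun hq a
  have h₃ : N.mkQ n = 0 := (Submodule.Quotient.mk_eq_zero N).2 n.2
  have h₄ : r (s a) = 0 := LinearMap.congr_fun hrs a
  have h₅ : r n = n := LinearMap.congr_fun hrN n
  change (q (N.mkQ (s a + n)), r (s a + n)) = (a, n)
  rw [map_add, h₁, h₃, add_zero, h₂, map_add, h₄, h₅, zero_add]

theorem finrank_ext_quotient {K : Type*} [Field K] [Linear K (ModuleCat.{u} R)] {M : Type u}
    [AddCommGroup M] [Module R M] {N M' : Submodule R M} (h : IsCompl N M')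
    [Module.Projective R N] (Z : ModuleCat.{u} R) :
    Module.finrank K (Abelian.Ext.{u} (ModuleCat.of R M) Z 1) =
      Module.finrank K (Abelian.Ext.{u} (ModuleCat.of R (M ⧸ N)) Z 1) := by
  obtain ⟨r, s, -, -, hs, hsum⟩ := exists_splitting h
  have : Projective (ModuleCat.of R N) := (IsProjective.iff_projective N).1 inferInstance
  exact finrank_ext_eq_of_retract (ModuleCat.ofHom N.mkQ) (ModuleCat.ofHom s) (ModuleCat.ofHom r)
    (ModuleCat.ofHom N.subtype) (ModuleCat.hom_ext hs) (ModuleCat.hom_ext hsum) Z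

end Modules

/-! ### Hom spaces into powers and into germs. -/

section Dimension

variable {K : Type u} [Field K] {M : Type u} [AddCommGroup M] [Module (Alg K) M]
  [Module K M] [IsScalarTower K (Alg K) M]

/-- Morphisms in the category of modules as linear maps, compatibly with scalars in `K`. -/
def categoryHomEquiv (A : ModuleCat.{u} (Alg K)) {B : ModuleCat.{u} (Alg K)} {X : Type u}
    [AddCommGroup X] [Module (Alg K) X] [Module K X] [IsScalarTower K (Alg K) X]
    (j : B ≃ₗ[Alg K] X) : (A ⟶ B) ≃ₗ[K] (A →ₗ[Alg K] X) where
  toFun f := j.toLinearMap ∘ₗ f.hom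
  invFun f := ModuleCat.ofHom (j.symm.toLinearMap ∘ₗ f)
  map_add' _ _ := LinearMap.ext fun _ => map_add j _ _
  map_smul' c f := LinearMap.ext fun m =>
    (map_smul j (algebraMap K (Alg K) c) (f.hom m)).trans (algebraMap_smul (Alg K) c _)
  left_inv _ := ModuleCat.hom_ext (LinearMap.ext fun _ => j.symm_apply_apply _)
  right_inv _ := LinearMap.ext fun _ => j.apply_symm_apply _

/-- Homomorphisms to a power are families of homomorphisms. -/
def homPiEquiv (M X : Type*) [AddCommGroup M] [Module (Alg K) M] [AddCommGroup X]
    [Module (Alg K) X] [Module K X] [IsScalarTower K (Alg K) X] (k : ℕ) :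
    (M →ₗ[Alg K] (Fin k → X)) ≃ₗ[K] (Fin k → (M →ₗ[Alg K] X)) where
  toFun f i := LinearMap.proj i ∘ₗ f
  invFun f := LinearMap.pi f
  map_add' _ _ := rfl
  map_smul' _ _ := rfl
  left_inv _ := rfl
  right_inv _ := rfl

theorem finite_and_finrank_hom_pi (A : ModuleCat.{u} (Alg K)) {B : ModuleCat.{u} (Alg K)}
    (X : Type u) [AddCommGroup X] [Module (Alg K) X] [Module K X] [IsScalarTower K (Alg K) X]
    {k : ℕ} (j : B ≃ₗ[Alg K] (Fin k → X)) [Module.Finite K (A →ₗ[Alg K] X)] :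
    Module.Finite K (A ⟶ B) ∧
      Module.finrank K (A ⟶ B) = k * Module.finrank K (A →ₗ[Alg K] X) := by
  let f := (categoryHomEquiv A j).trans (homPiEquiv (K := K) A X k)
  refine ⟨Module.Finite.equiv f.symm, ?_⟩
  rw [f.finrank_eq, Module.finrank_pi_fintype]
  simp

variable (K M) in
/-- Homomorphisms to the germ module factor through `M / IM`. -/
noncomputable def homGermEquiv :
    ((M ⧸ IM K M) →ₗ[Alg K] Germ K) ≃ₗ[K] (M →ₗ[Alg K] Germ K) where
  toFun f := f ∘ₗ (IM K M).mkQ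
  invFun f := (IM K M).liftQ f
    (IM_le_of_e_smul_mem fun m => by rw [LinearMap.mem_ker, map_smul, e_smul_germ])
  map_add' _ _ := rfl
  map_smul' _ _ := rfl
  left_inv f := by ext; rfl
  right_inv f := by ext; rfl

omit [Module K M] [IsScalarTower K (Alg K) M] in
theorem e_smul_quotient_IM (v : M ⧸ IM K M) : e K • v = 0 := by
  obtain ⟨m, rfl⟩ := (IM K M).mkQ_surjective v
  rw [← map_smul, Submodule.mkQ_apply, Submodule.Quotient.mk_eq_zero]
  exact e_smul_mem_IM m

theorem finite_quotient_IM (hM : IsFiniteLength (Alg K) M) : Module.Finite K (M ⧸ IM K M) :=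
  finite_of_isFiniteLength (hM.of_surjective (IM K M).mkQ_surjective) e_smul_quotient_IM

/-- Homomorphisms to the germ module are functionals on `M / IM`. -/
noncomputable def dualEquivHomGerm (hM : IsFiniteLength (Alg K) M) :
    Module.Dual K (M ⧸ IM K M) ≃ₗ[K] (M →ₗ[Alg K] Germ K) :=
  have := finite_quotient_IM hM
  (LinearEquiv.ofBijective _ (dualToGerm_bijective e_smul_quotient_IM)).trans (homGermEquiv K M)

end Dimension

/-! ### Splitting off copies of `S₁`, and the dimension formula. -/

section Summand

variable {K : Type u} [Field K] {M : Type u} [AddCommGroup M] [Module (Alg K) M]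

/-- A nonzero map is onto by simplicity and splits by projectivity. -/
theorem hom_eq_zero_of_noS₁Summand (hM : NoS₁Summand K M) (f : M →ₗ[Alg K] S₁ K) : f = 0 := by
  by_contra hf
  obtain ⟨g, hg⟩ := exists_section_of_ne_zero hf
  exact hM (exists_isCompl_of_retract (R := Alg K) (M := M) (X := S₁ K) hg)

theorem subsingleton_hom_of_noS₁Summand (hM : NoS₁Summand K M) (k : ℕ) :
    Subsingleton (ModuleCat.of (Alg K) M ⟶ ModuleCat.of (Alg K) (Fin k → S₁ K)) := by
  refine subsingleton_of_forall_eq 0 fun f => ModuleCat.hom_ext (LinearMap.ext fun m => ?_)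
  funext i
  exact LinearMap.congr_fun (hom_eq_zero_of_noS₁Summand hM (LinearMap.proj i ∘ₗ f.hom)) m

theorem length_pi_S₁ (n : ℕ) : Module.length (Alg K) (Fin n → S₁ K) = n := by
  rw [Module.length_pi (R := Alg K) (M := S₁ K), Module.length_eq_one]
  simp

theorem bddAbove_summands (hM : IsFiniteLength (Alg K) M) :
    BddAbove {n : ℕ | ∃ N : Submodule (Alg K) M, IsSummand N n} := by
  refine ⟨(Module.length (Alg K) M).toNat, ?_⟩
  rintro n ⟨N, -, ⟨f⟩⟩
  have h : (n : ℕ∞) ≤ Module.length (Alg K) M := by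
    rw [← length_pi_S₁ (K := K) n,
      ← LinearEquiv.length_eq (R := Alg K) (M := N) (N := Fin n → S₁ K) f]
    exact Module.length_le_of_injective N.subtype Subtype.val_injective
  exact (ENat.natCast_le_natCast.1 (by rwa [ENat.natCast_toNat (Module.length_ne_top_iff.2 hM)]))

theorem isGreatest_d (hM : IsFiniteLength (Alg K) M) :
    IsGreatest {n : ℕ | ∃ N : Submodule (Alg K) M, IsSummand N n} (d K M) := by
  -- The zero submodule shows that the set is nonempty, so the supremum is attained.
  refine ⟨Nat.sSup_mem ⟨0, ⊥, ⟨⊤, isCompl_bot_top⟩, ⟨?_⟩⟩ (bddAbove_summands hM),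
    fun n hn => le_csSup (bddAbove_summands hM) hn⟩
  exact
    { toFun := 0
      map_add' := fun _ _ => Subsingleton.elim _ _
      map_smul' := fun _ _ => Subsingleton.elim _ _
      invFun := 0
      left_inv := fun _ => Subsingleton.elim _ _
      right_inv := fun _ => Subsingleton.elim _ _ }

/-- A copy of `S₁` splitting off `M/N` would combine with `N` to a summand `S₁^{d(M)+1}` of `M`. -/
theorem noS₁Summand_quotient (hM : IsFiniteLength (Alg K) M) {N : Submodule (Alg K) M}
    (hN : IsSummand N (d K M)) : NoS₁Summand K (M ⧸ N) := by
  rintro ⟨L, L', hL, ⟨f⟩⟩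
  obtain ⟨⟨M', hM'⟩, ⟨g⟩⟩ := hN
  obtain ⟨P, P', hP, ⟨h⟩⟩ := exists_isCompl_of_quotient (R := Alg K) (M := M) hM' hL
  have hd := (isGreatest_d hM).2 ⟨P, ⟨P', hP⟩, ⟨(h.trans (f.prodCongr g)).trans
    (Fin.consLinearEquiv (Alg K) fun _ : Fin (d K M + 1) => S₁ K)⟩⟩
  omega

theorem IsSummand.projective {N : Submodule (Alg K) M} {n : ℕ} (hN : IsSummand N n) :
    Module.Projective (Alg K) N := by
  obtain ⟨-, ⟨g⟩⟩ := hN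
  have := projective_pi_of_finite (R := Alg K) (ι := Fin n) (S := S₁ K)
  exact Module.Projective.of_equiv g.symm

variable [Module K M] [IsScalarTower K (Alg K) M]

/-- Finiteness needs only the Hom spaces into `Seq` and `Germ`, so it holds for every finite-length
`M`; the absence of summands enters only to kill `Hom(M, S₁ᵏ)`. The additive form avoids truncated
subtraction. -/
theorem finite_and_finrank_extS₁ (hM : IsFiniteLength (Alg K) M) (k : ℕ) :
    Module.Finite K (ExtS₁ K M k) ∧
      (NoS₁Summand K M → Module.finrank K (ExtS₁ K M k) +
        k * (Module.length (Alg K) (IM K M)).toNat = k * Module.finrank K (M ⧸ IM K M)) := by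
  have := finite_corner hM
  have := finite_quotient_IM hM
  have : Module.Finite K (M →ₗ[Alg K] Seq K) := Module.Finite.equiv (homSeqEquiv K M).symm
  have : Module.Finite K (M →ₗ[Alg K] Germ K) := Module.Finite.equiv (dualEquivHomGerm hM)
  obtain ⟨h₁, h₂⟩ := finite_and_finrank_hom_pi (K := K) (ModuleCat.of (Alg K) M)
    (B := ModuleCat.of (Alg K) (Fin k → Seq K)) (Seq K) (LinearEquiv.refl _ _)
  obtain ⟨h₃, h₄⟩ := finite_and_finrank_hom_pi (K := K) (ModuleCat.of (Alg K) M)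
    (B := ModuleCat.of (Alg K) (Fin k → Germ K)) (Germ K) (LinearEquiv.refl _ _)
  have hext := fun h => finite_and_finrank_ext_pi (R := Alg K) (K := K) (A := S₁ K) (B := Seq K)
    (C := Germ K) (i := toSeq K) (p := germMk) toSeq_injective h germMk_surjective
    (ModuleCat.of (Alg K) M) k
  obtain ⟨h₅, h₆⟩ := hext range_toSeq_eq_ker_germMk h₁ h₃
  refine ⟨h₅, fun h => ?_⟩
  have h₆ := h₆ (subsingleton_hom_of_noS₁Summand h k)
  rw [h₂, h₄] at h₆
  rw [← finrank_corner hM, ← Subspace.dual_finrank_eq (V := corner K M),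
    ← (homSeqEquiv K M).finrank_eq, ← Subspace.dual_finrank_eq (V := M ⧸ IM K M),
    (dualEquivHomGerm hM).finrank_eq]
  exact h₆

end Summand

end ToeplitzJacobson

theorem corollary4 {K : Type u} [Field K] {M : Type u} [AddCommGroup M]
    [Module (ToeplitzJacobson.Alg K) M] [Module K M] [IsScalarTower K (ToeplitzJacobson.Alg K) M]
    (hM : IsFiniteLength (ToeplitzJacobson.Alg K) M) (k : ℕ) :
    -- the case without `S₁`-direct summands
    (ToeplitzJacobson.NoS₁Summand K M →
      Module.Finite K (ToeplitzJacobson.ExtS₁ K M k) ∧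
      Module.Finite K (M ⧸ ToeplitzJacobson.IM K M) ∧
      Module.length (ToeplitzJacobson.Alg K) (ToeplitzJacobson.IM K M) ≠ ⊤ ∧
      (Module.finrank K (ToeplitzJacobson.ExtS₁ K M k) : ℤ) =
        k * ((Module.finrank K (M ⧸ ToeplitzJacobson.IM K M) : ℤ) -
          ((Module.length (ToeplitzJacobson.Alg K) (ToeplitzJacobson.IM K M)).toNat : ℤ))) ∧
    -- the general case: `d(M)` is an attained maximum, and a summand `N ≅ S₁^{⊕ d(M)}` splits off
    IsGreatest {n : ℕ | ∃ N : Submodule (ToeplitzJacobson.Alg K) M,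
        ToeplitzJacobson.IsSummand N n} (ToeplitzJacobson.d K M) ∧
    ∀ N : Submodule (ToeplitzJacobson.Alg K) M,
      ToeplitzJacobson.IsSummand N (ToeplitzJacobson.d K M) →
      ToeplitzJacobson.NoS₁Summand K (M ⧸ N) ∧
      Module.Finite K (ToeplitzJacobson.ExtS₁ K M k) ∧
      Module.Finite K (ToeplitzJacobson.ExtS₁ K (M ⧸ N) k) ∧
      Module.finrank K (ToeplitzJacobson.ExtS₁ K M k) =
        Module.finrank K (ToeplitzJacobson.ExtS₁ K (M ⧸ N) k) := by
  obtain ⟨hfin, hrank⟩ := ToeplitzJacobson.finite_and_finrank_extS₁ hM k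
  refine ⟨fun h => ⟨hfin, ToeplitzJacobson.finite_quotient_IM hM,
    ToeplitzJacobson.length_IM_ne_top hM, ?_⟩, ToeplitzJacobson.isGreatest_d hM, fun N hN => ?_⟩
  · have hrank := hrank h
    rw [mul_sub, eq_sub_iff_add_eq]
    exact_mod_cast hrank
  · obtain ⟨M', hM'⟩ := hN.1
    have := hN.projective
    refine ⟨ToeplitzJacobson.noS₁Summand_quotient hM hN, hfin, ?_,
      ToeplitzJacobson.finrank_ext_quotient (R := ToeplitzJacobson.Alg K) hM' _⟩
    exact (ToeplitzJacobson.finite_and_finrank_extS₁ (hM.of_surjective N.mkQ_surjective) k).1
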